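/- Let $\Gamma$ be a finite connected simplicial graph with vertex set $V$, and let $A_\Gamma$ be the associated right-angled Artin group: its generators are the vertices, and its relations say that adjacent vertices commute. For $\Theta\subseteq V$ let $A_\Theta$ denote the subgroup of $A_\Gamma$ generated by $\Theta$. Write $lk(v)$ for the set of neighbours of $v$ and $st(v)=lk(v)\cup\{v\}$. Put $v\le w$ if $lk(v)\subseteq st(w)$, and $v\sim w$ if $v\le w$ and $w\le v$. Then $\sim$ is an equivalence relation, and $\le$ induces a partial order on the equivalence classes $[v]$. For a class $[v]$ let $L_{[v]}=lk(v)\setminus[v]$ and $J_{[v]}=L_{[v]}\cup[v]$. Let $Aut^0(A_\Gamma)\le Aut(A_\Gamma)$ be the subgroup generated by the inner automorphisms, the inversions ($v\mapsto v^{-1}$, other generators fixed), the partial conjugations (conjugation by a vertex $v$ of all generators in one connected component of $\Gamma-st(v)$, other generators fixed), and the transvections ($v\mapsto vw$ for $v\ne w$, $v\le w$, other generators fixed). Let $Out^0(A_\Gamma)$ be its image in $Out(A_\Gamma)$. For each maximal class $[v]$, every $\phi\in Out^0(A_\Gamma)$ has a representative $\phi_v\in Aut^0(A_\Gamma)$ that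 preserves $A_{[v]}$ and $A_{J_{[v]}}$, and sending $\phi$ to the class of $\phi_v|_{A_{J_{[v]}}}$ gives a well-defined restriction homomorphism $R_{[v]}:Out^0(A_\Gamma)\to Out(A_{J_{[v]}})$. Let $$R=\prod R_{[v]}:Out^0(A_\Gamma)\to\prod Out(A_{J_{[v]}}),$$ where the products are taken over all maximal classes $[v]$. Then the kernel $K$ of $R$ is a finitely generated free abelian group. -/

import Mathlib

/-! ### Right-angled Artin groups -/

/-- The right-angled Artin group `A_Γ`: generated by the vertices of `G`, with the commutators of
adjacent vertices as relators. -/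
abbrev RAAG {V : Type*} (G : SimpleGraph V) : Type _ :=
  PresentedGroup {r : FreeGroup V | ∃ a b, G.Adj a b ∧
    r = FreeGroup.of a * FreeGroup.of b * (FreeGroup.of a)⁻¹ * (FreeGroup.of b)⁻¹}

namespace RAAG

variable {V : Type*} (G : SimpleGraph V)

/-- The standard generator of `A_Γ` given by the vertex `v`. -/
def gen (v : V) : RAAG G := PresentedGroup.of v

/-- The special subgroup `A_Θ`, generated by a set `Θ` of vertices. -/
def special (S : Set V) : Subgroup (RAAG G) := Subgroup.closure (gen G '' S)

/-! ### The order on vertices, equivalence classes and joins -/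

/-- The closed star of a vertex. -/
def star (v : V) : Set V := insert v (G.neighborSet v)

/-- `v ≤ w` iff `lk(v) ⊆ st(w)`. -/
def Dom (v w : V) : Prop := G.neighborSet v ⊆ star G w

/-- The equivalence class `[v]`, as a set of vertices. -/
def cls (v : V) : Set V := {w | Dom G v w ∧ Dom G w v}

/-- The vertex `v` represents a maximal equivalence class. -/
def IsMaxVertex (v : V) : Prop := ∀ w, Dom G v w → Dom G w v

/-- The type of maximal equivalence classes of vertices. -/
def MaxClass : Type _ := {c : Set V // ∃ v, IsMaxVertex G v ∧ c = cls G v}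

/-- `L_c`: the vertices outside the class `c` that are adjacent to `c`.
For `c = [v]` this is `lk(v) \ [v]`, see `classLink_cls`. -/
def classLink (c : Set V) : Set V := {w | w ∉ c ∧ ∃ v ∈ c, G.Adj v w}

/-- The vertex set of the join `J_c = L_c * c`. -/
def classJoin (c : Set V) : Set V := classLink G c ∪ c

theorem Dom.trans {G : SimpleGraph V} {u v w : V} (h : Dom G u v) (h' : Dom G v w) :
    Dom G u w := by
  intro x hx
  rcases h hx with rfl | hxv
  · rcases h' (SimpleGraph.Adj.symm hx) with rfl | hw
    · exact Or.inr hx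
    · rcases h (SimpleGraph.Adj.symm hw) with rfl | hwx
      · exact Or.inl rfl
      · exact Or.inr (SimpleGraph.Adj.symm hwx)
  · exact h' hxv

theorem classLink_cls (v : V) : classLink G (cls G v) = G.neighborSet v \ cls G v := by
  have hv : v ∈ cls G v := ⟨fun _ h => Or.inr h, fun _ h => Or.inr h⟩
  ext w
  constructor
  · rintro ⟨hw, u, hu, huw⟩
    refine ⟨?_, hw⟩
    rcases hu.2 huw with h | h
    · exact absurd (h ▸ hv) hw
    · exact h
  · rintro ⟨h, hw⟩
    exact ⟨hw, v, hv, h⟩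

/-! ### Outer automorphisms and pure automorphisms -/

instance conj_range_normal (A : Type*) [Group A] :
    ((MulAut.conj : A →* MulAut A).range).Normal := by
  constructor
  rintro _ ⟨g, rfl⟩ φ
  refine ⟨φ g, ?_⟩
  ext x
  simp [MulAut.mul_apply, MulAut.conj_apply]

/-- The outer automorphism group of a group. -/
abbrev Out (A : Type*) [Group A] : Type _ := MulAut A ⧸ (MulAut.conj : A →* MulAut A).range

/-- The class of an automorphism in the outer automorphism group. -/
abbrev outMk (A : Type*) [Group A] : MulAut A →* Out A :=
  QuotientGroup.mk' (MulAut.conj : A →* MulAut A).range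

/-- Inversions send one generator to its inverse and fix the others. -/
def IsInversion (φ : MulAut (RAAG G)) : Prop :=
  ∃ v, φ (gen G v) = (gen G v)⁻¹ ∧ ∀ u, u ≠ v → φ (gen G u) = gen G u

/-- Transvections: `v ↦ v w` where `v ≤ w`, `v ≠ w`; all other generators are fixed. -/
def IsTransvection (φ : MulAut (RAAG G)) : Prop :=
  ∃ v w, v ≠ w ∧ Dom G v w ∧ φ (gen G v) = gen G v * gen G w ∧
    ∀ u, u ≠ v → φ (gen G u) = gen G u

/-- Partial conjugations: the generators in one connected component `C` of `Γ - st(v)` are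
conjugated by `v`, the others are fixed. (If `Γ - st(v)` is connected this is inner.) -/
def IsPartialConj (φ : MulAut (RAAG G)) : Prop :=
  ∃ (v : V) (C : (G.induce (star G v)ᶜ).ConnectedComponent),
    (∀ u ∈ C.supp, φ (gen G u) = gen G v * gen G u * (gen G v)⁻¹) ∧
    ∀ u, u ∉ Subtype.val '' C.supp → φ (gen G u) = gen G u

/-- The pure automorphism group `Aut⁰(A_Γ)`. -/
def pureAut : Subgroup (MulAut (RAAG G)) :=
  Subgroup.closure {φ | φ ∈ (MulAut.conj : RAAG G →* MulAut (RAAG G)).range ∨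
    IsInversion G φ ∨ IsPartialConj G φ ∨ IsTransvection G φ}

/-- The group `Out⁰(A_Γ)` of pure outer automorphisms. -/
def pureOut : Subgroup (Out (RAAG G)) := (pureAut G).map (outMk (RAAG G))

/-! ### Restriction to the joins -/

/-- The automorphisms of `A` that preserve the subgroup `H`. -/
def stab {A : Type*} [Group A] (H : Subgroup A) : Subgroup (MulAut A) where
  carrier := {φ | H.map φ.toMonoidHom = H}
  one_mem' := by
    ext x
    simp
  mul_mem' {φ ψ} hφ hψ := by
    change H.map (φ * ψ).toMonoidHom = H
    have h : (φ * ψ).toMonoidHom = φ.toMonoidHom.comp ψ.toMonoidHom := rfl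
    rw [h, ← Subgroup.map_map, hψ, hφ]
  inv_mem' {φ} hφ := by
    change H.map (φ⁻¹).toMonoidHom = H
    have h : (φ⁻¹).toMonoidHom.comp φ.toMonoidHom = MonoidHom.id A := by
      ext x
      exact φ.symm_apply_apply x
    conv_lhs => rw [← show H.map φ.toMonoidHom = H from hφ]
    rw [Subgroup.map_map, h, Subgroup.map_id]

/-- The restriction to `H` of an automorphism that preserves `H`. -/
def restrictAut {A : Type*} [Group A] (H : Subgroup A) (φ : MulAut A) (h : φ ∈ stab H) :
    MulAut H :=
  (φ.subgroupMap H).trans (MulEquiv.subgroupCongr h)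

theorem restrictAut_apply {A : Type*} [Group A] (H : Subgroup A) (φ : MulAut A) (h : φ ∈ stab H)
    (x : H) : (restrictAut H φ h x : A) = φ x := rfl

theorem gen_comm {a b : V} (h : G.Adj a b) : gen G a * gen G b = gen G b * gen G a := by
  have h1 : gen G a * gen G b * (gen G a)⁻¹ * (gen G b)⁻¹ = 1 :=
    PresentedGroup.one_of_mem ⟨a, b, h, rfl⟩
  rwa [mul_inv_eq_one, mul_inv_eq_iff_eq_mul] at h1

theorem gen_mem {S : Set V} {u : V} (h : u ∈ S) : gen G u ∈ special G S :=
  Subgroup.subset_closure ⟨u, h, rfl⟩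

/-- The retraction of `A_Γ` onto a special subgroup that kills the other generators. -/
theorem exists_retraction (S : Set V) :
    ∃ r : RAAG G →* special G S, ∀ x : special G S, r x = x := by
  classical
  let f : V → special G S := fun v => if h : v ∈ S then ⟨gen G v, gen_mem G h⟩ else 1
  have hf : ∀ r ∈ {r : FreeGroup V | ∃ a b, G.Adj a b ∧
      r = FreeGroup.of a * FreeGroup.of b * (FreeGroup.of a)⁻¹ * (FreeGroup.of b)⁻¹},
      FreeGroup.lift f r = 1 := by
    rintro _ ⟨a, b, hab, rfl⟩
    rw [map_mul, map_mul, map_mul, map_inv, map_inv, FreeGroup.lift_apply_of,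
      FreeGroup.lift_apply_of, mul_inv_eq_one, mul_inv_eq_iff_eq_mul]
    by_cases ha : a ∈ S <;> by_cases hb : b ∈ S <;> simp [f, ha, hb, gen_comm G hab]
  refine ⟨PresentedGroup.toGroup hf, ?_⟩
  have key : ∀ x ∈ special G S, ((PresentedGroup.toGroup hf x : special G S) : RAAG G) = x := by
    intro x hx
    refine Subgroup.closure_induction ?_ ?_ ?_ ?_ hx
    · rintro _ ⟨u, hu, rfl⟩
      have : PresentedGroup.toGroup hf (gen G u) = f u := PresentedGroup.toGroup.of hf
      rw [this]
      simp [f, hu]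
    · simp
    · intro x y _ _ h1 h2
      simp [h1, h2]
    · intro x _ h1
      simp [h1]
  intro x
  exact Subtype.ext (key x x.2)

/-- Two automorphisms that preserve `A_Θ` and agree up to an inner automorphism of `A_Γ` have
restrictions to `A_Θ` that agree up to an inner automorphism of `A_Θ`. -/
theorem outMk_restrict_eq (S : Set V) {φ ψ : MulAut (RAAG G)}
    (hφ : φ ∈ stab (special G S)) (hψ : ψ ∈ stab (special G S))
    (h : outMk (RAAG G) φ = outMk (RAAG G) ψ) :
    outMk (special G S) (restrictAut _ φ hφ) = outMk (special G S) (restrictAut _ ψ hψ) := by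
  obtain ⟨r, hr⟩ := exists_retraction G S
  obtain ⟨g, hg⟩ := QuotientGroup.eq.1 h
  refine QuotientGroup.eq.2 ⟨r g, ?_⟩
  rw [eq_inv_mul_iff_mul_eq] at hg ⊢
  ext x
  have h1 : φ (g * x * g⁻¹) = ψ x := by rw [← hg]; rfl
  have h2 : g * (x : RAAG G) * g⁻¹ ∈ special G S := by
    have h3 : g * (x : RAAG G) * g⁻¹ = φ⁻¹ (ψ x) := by
      rw [← h1]
      exact (φ.symm_apply_apply _).symm
    have h4 := (stab (special G S)).mul_mem ((stab (special G S)).inv_mem hφ) hψ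
    have h5 : (φ⁻¹ * ψ) (x : RAAG G) ∈
        (special G S).map (φ⁻¹ * ψ).toMonoidHom := ⟨x, x.2, rfl⟩
    rw [show (special G S).map (φ⁻¹ * ψ).toMonoidHom = special G S from h4] at h5
    rw [h3]
    exact h5
  have h6 := congrArg Subtype.val (hr ⟨_, h2⟩)
  simp only [map_mul, map_inv, hr] at h6
  rw [restrictAut_apply, ← h1, ← h6]
  rfl

theorem mem_stab_special (S : Set V) (φ : MulAut (RAAG G))
    (h1 : ∀ s ∈ S, φ (gen G s) ∈ special G S)
    (h2 : ∀ s ∈ S, ∃ y ∈ special G S, φ y = gen G s) : φ ∈ stab (special G S) := by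
  change (special G S).map φ.toMonoidHom = special G S
  apply le_antisymm
  · rw [Subgroup.map_le_iff_le_comap]
    refine (Subgroup.closure_le _).2 ?_
    rintro _ ⟨s, hs, rfl⟩
    exact h1 s hs
  · refine (Subgroup.closure_le _).2 ?_
    rintro _ ⟨s, hs, rfl⟩
    exact h2 s hs

theorem inversion_mem_stab (S : Set V) {φ : MulAut (RAAG G)} (h : IsInversion G φ) :
    φ ∈ stab (special G S) := by
  obtain ⟨v, hv, hu⟩ := h
  refine mem_stab_special G S φ (fun s hs => ?_) (fun s hs => ?_)
  · by_cases hsv : s = v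
    · rw [hsv, hv, ← hsv]
      exact inv_mem (gen_mem G hs)
    · rw [hu s hsv]
      exact gen_mem G hs
  · by_cases hsv : s = v
    · refine ⟨(gen G s)⁻¹, inv_mem (gen_mem G hs), ?_⟩
      rw [map_inv, hsv, hv, inv_inv]
    · exact ⟨gen G s, gen_mem G hs, hu s hsv⟩

theorem transvection_mem_stab (S : Set V) {φ : MulAut (RAAG G)} {v w : V} (hvw : v ≠ w)
    (hv : φ (gen G v) = gen G v * gen G w) (hu : ∀ u, u ≠ v → φ (gen G u) = gen G u)
    (hS : v ∈ S → w ∈ S) : φ ∈ stab (special G S) := by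
  refine mem_stab_special G S φ (fun s hs => ?_) (fun s hs => ?_)
  · by_cases hsv : s = v
    · subst hsv
      rw [hv]
      exact mul_mem (gen_mem G hs) (gen_mem G (hS hs))
    · rw [hu s hsv]
      exact gen_mem G hs
  · by_cases hsv : s = v
    · subst hsv
      refine ⟨gen G s * (gen G w)⁻¹,
        mul_mem (gen_mem G hs) (inv_mem (gen_mem G (hS hs))), ?_⟩
      rw [map_mul, map_inv, hv, hu w hvw.symm, mul_inv_cancel_right]
    · exact ⟨gen G s, gen_mem G hs, hu s hsv⟩

/-- An automorphism that fixes `w` and conjugates each generator in `Θ` by `w` or fixes it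
preserves `A_Θ`, if `w` lies in `Θ` or all generators of `Θ` are fixed. -/
theorem conj_mem_stab (S : Set V) {φ : MulAut (RAAG G)} {w : V}
    (hw : φ (gen G w) = gen G w)
    (h : ∀ s ∈ S, φ (gen G s) = gen G s ∨
      (w ∈ S ∧ φ (gen G s) = gen G w * gen G s * (gen G w)⁻¹)) : φ ∈ stab (special G S) := by
  refine mem_stab_special G S φ (fun s hs => ?_) (fun s hs => ?_)
  · rcases h s hs with h | ⟨hwS, h⟩
    · rw [h]
      exact gen_mem G hs
    · rw [h]
      exact mul_mem (mul_mem (gen_mem G hwS) (gen_mem G hs)) (inv_mem (gen_mem G hwS))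
  · rcases h s hs with h | ⟨hwS, h⟩
    · exact ⟨gen G s, gen_mem G hs, h⟩
    · refine ⟨(gen G w)⁻¹ * gen G s * gen G w,
        mul_mem (mul_mem (inv_mem (gen_mem G hwS)) (gen_mem G hs)) (gen_mem G hwS), ?_⟩
      rw [map_mul, map_mul, map_inv, hw, h]
      group

/-- If `[v]` is maximal and `w ∉ J_[v]` then `J_[v] - st(w)` lies in one component of
`Γ - st(w)`. -/
theorem join_sub_star_connected {v w : V} (hv : IsMaxVertex G v)
    (hw : w ∉ classJoin G (cls G v)) :
    ∃ D : (G.induce (star G w)ᶜ).ConnectedComponent,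
      ∀ u (hu : u ∉ star G w), u ∈ classJoin G (cls G v) →
        (G.induce (star G w)ᶜ).connectedComponentMk ⟨u, hu⟩ = D := by
  have hvv : v ∈ cls G v := ⟨fun _ h => Or.inr h, fun _ h => Or.inr h⟩
  have hc : ∀ u ∈ cls G v, u ∉ star G w := by
    intro u hu hs
    apply hw
    rcases hs with rfl | hs
    · exact Or.inr hu
    · by_cases hwc : w ∈ cls G v
      · exact Or.inr hwc
      · exact Or.inl ⟨hwc, u, hu, SimpleGraph.Adj.symm hs⟩
  have adj : ∀ {a b : V} (ha : a ∉ star G w) (hb : b ∉ star G w), G.Adj a b →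
      (G.induce (star G w)ᶜ).connectedComponentMk ⟨a, ha⟩ =
        (G.induce (star G w)ᶜ).connectedComponentMk ⟨b, hb⟩ := by
    intro a b ha hb hab
    refine SimpleGraph.ConnectedComponent.sound (SimpleGraph.Adj.reachable ?_)
    exact hab
  have hL : ∀ l ∈ classLink G (cls G v), ∀ u ∈ cls G v, G.Adj l u := by
    intro l hl u hu
    rw [classLink_cls] at hl
    rcases hu.1 hl.1 with rfl | h
    · exact absurd hu hl.2
    · exact SimpleGraph.Adj.symm h
  by_cases hsub : ∃ l ∈ classLink G (cls G v), l ∉ star G w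
  · obtain ⟨l, hl, hls⟩ := hsub
    refine ⟨(G.induce (star G w)ᶜ).connectedComponentMk ⟨v, hc v hvv⟩, ?_⟩
    rintro u hu (huL | huc)
    · exact adj _ _ (hL u huL v hvv)
    · exact (adj hu hls (SimpleGraph.Adj.symm (hL l hl u huc))).trans (adj _ _ (hL l hl v hvv))
  · push Not at hsub
    have hnd : ¬ Dom G v w := fun h => hw (Or.inr ⟨h, hv w h⟩)
    obtain ⟨t, ht, hts⟩ := Set.not_subset.1 hnd
    have htc : t ∈ cls G v := by
      by_contra hn
      refine hts (hsub t ?_)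
      rw [classLink_cls]
      exact ⟨ht, hn⟩
    refine ⟨(G.induce (star G w)ᶜ).connectedComponentMk ⟨t, hts⟩, ?_⟩
    rintro u hu (huL | huc)
    · exact absurd (hsub u huL) hu
    · rcases huc.1 ht with h | h
      · subst h
        rfl
      · exact adj _ _ h

/-- The class of a pure automorphism has a representative which preserves both `A_[v]` and
`A_{J_[v]}`, for every maximal `[v]`. -/
theorem pureOut_le (c : MaxClass G) :
    pureOut G ≤ (pureAut G ⊓ (stab (special G c.1) ⊓ stab (special G (classJoin G c.1)))).map
      (outMk (RAAG G)) := by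
  have inner : ∀ g : RAAG G, outMk (RAAG G) (MulAut.conj g) = 1 := fun g =>
    (QuotientGroup.eq_one_iff _).2 ⟨g, rfl⟩
  have innerP : ∀ g : RAAG G, MulAut.conj g ∈ pureAut G := fun g =>
    Subgroup.subset_closure (Or.inl ⟨g, rfl⟩)
  rw [pureOut, Subgroup.map_le_iff_le_comap]
  refine (Subgroup.closure_le _).2 ?_
  intro φ hφ
  have hP : φ ∈ pureAut G := Subgroup.subset_closure hφ
  obtain ⟨c, v, hv, rfl⟩ := c
  have hvv : v ∈ cls G v := ⟨fun _ h => Or.inr h, fun _ h => Or.inr h⟩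
  change outMk (RAAG G) φ ∈ Subgroup.map _ _
  rcases hφ with ⟨g, rfl⟩ | hi | ⟨w, C, hC, hC'⟩ | ⟨u, w, huw, hle, hu, hfix⟩
  · rw [inner]
    exact one_mem _
  · exact ⟨φ, ⟨hP, inversion_mem_stab G _ hi, inversion_mem_stab G _ hi⟩, rfl⟩
  · have hstar : ∀ u ∈ star G w, u ∉ Subtype.val '' C.supp := by
      rintro u hu ⟨⟨u', hu'⟩, -, rfl⟩
      exact hu' hu
    have hw : φ (gen G w) = gen G w := hC' w (hstar w (Or.inl rfl))
    have hcase : ∀ s, φ (gen G s) = gen G s ∨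
        φ (gen G s) = gen G w * gen G s * (gen G w)⁻¹ := by
      intro s
      by_cases hs : s ∈ Subtype.val '' C.supp
      · obtain ⟨s, hs, rfl⟩ := hs
        exact Or.inr (hC s hs)
      · exact Or.inl (hC' s hs)
    by_cases hwJ : w ∈ classJoin G (cls G v)
    · refine ⟨φ, ⟨hP, conj_mem_stab G _ hw fun s hs => ?_,
        conj_mem_stab G _ hw fun s hs => ?_⟩, rfl⟩
      · rcases hwJ with hwL | hwc
        · left
          refine hC' s (hstar s (Or.inr ?_))
          rw [classLink_cls] at hwL
          rcases hs.1 hwL.1 with rfl | h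
          · exact absurd hs hwL.2
          · exact SimpleGraph.Adj.symm h
        · exact (hcase s).imp id fun h => ⟨hwc, h⟩
      · exact (hcase s).imp id fun h => ⟨hwJ, h⟩
    · obtain ⟨D, hD⟩ := join_sub_star_connected G hv hwJ
      by_cases hDC : D = C
      · subst hDC
        have hψ : ∀ s ∈ classJoin G (cls G v),
            (MulAut.conj (gen G w)⁻¹ * φ) (gen G s) = gen G s := by
          intro s hs
          rw [MulAut.mul_apply, MulAut.conj_apply, inv_inv]
          by_cases hsw : s ∈ star G w
          · rw [hC' s (hstar s hsw)]
            rcases hsw with rfl | h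
            · group
            · rw [mul_assoc, ← gen_comm G h, inv_mul_cancel_left]
          · rw [hC ⟨s, hsw⟩ (hD s hsw hs)]
            group
        refine ⟨MulAut.conj (gen G w)⁻¹ * φ, ⟨mul_mem (innerP _) hP,
          mem_stab_special G _ _ (fun s hs => ?_) (fun s hs => ?_),
          mem_stab_special G _ _ (fun s hs => ?_) (fun s hs => ?_)⟩, ?_⟩
        · rw [hψ s (Or.inr hs)]
          exact gen_mem G hs
        · exact ⟨_, gen_mem G hs, hψ s (Or.inr hs)⟩
        · rw [hψ s hs]
          exact gen_mem G hs
        · exact ⟨_, gen_mem G hs, hψ s hs⟩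
        · rw [map_mul, inner, one_mul]
      · have hψ : ∀ s ∈ classJoin G (cls G v), φ (gen G s) = gen G s := by
          intro s hs
          refine hC' s ?_
          rintro ⟨⟨s, hs'⟩, hsC, rfl⟩
          exact hDC ((hD s hs' hs).symm.trans hsC)
        refine ⟨φ, ⟨hP, conj_mem_stab G _ hw fun s hs => Or.inl (hψ s (Or.inr hs)),
          conj_mem_stab G _ hw fun s hs => Or.inl (hψ s hs)⟩, rfl⟩
  · have h1 : u ∈ cls G v → w ∈ cls G v := fun huc =>
      have hvw := huc.1.trans hle
      ⟨hvw, hv w hvw⟩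
    have h2 : u ∈ classJoin G (cls G v) → w ∈ classJoin G (cls G v) := by
      rintro (huL | huc)
      · rw [classLink_cls] at huL
        rcases hle (SimpleGraph.Adj.symm huL.1) with rfl | h
        · exact Or.inr hvv
        · by_cases hwc : w ∈ cls G v
          · exact Or.inr hwc
          · exact Or.inl ⟨hwc, v, hvv, SimpleGraph.Adj.symm h⟩
      · exact Or.inr (h1 huc)
    exact ⟨φ, ⟨hP, transvection_mem_stab G _ huw hu hfix h1,
      transvection_mem_stab G _ huw hu hfix h2⟩, rfl⟩

theorem exists_rep (c : MaxClass G) (x : pureOut G) :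
    ∃ φ : MulAut (RAAG G), φ ∈ pureAut G ∧ φ ∈ stab (special G c.1) ∧
      φ ∈ stab (special G (classJoin G c.1)) ∧ outMk (RAAG G) φ = x := by
  obtain ⟨φ, ⟨h1, h2, h3⟩, h4⟩ := pureOut_le G c x.2
  exact ⟨φ, h1, h2, h3, h4⟩

/-- A representative `φ_v ∈ Aut⁰(A_Γ)` of a pure outer automorphism that preserves both `A_[v]`
and `A_{J_[v]}`. -/
noncomputable def rep (c : MaxClass G) (x : pureOut G) : MulAut (RAAG G) :=
  (exists_rep G c x).choose

theorem rep_mem_stab (c : MaxClass G) (x : pureOut G) :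
    rep G c x ∈ stab (special G (classJoin G c.1)) := (exists_rep G c x).choose_spec.2.2.1

theorem outMk_rep (c : MaxClass G) (x : pureOut G) : outMk (RAAG G) (rep G c x) = x :=
  (exists_rep G c x).choose_spec.2.2.2

/-- The restriction homomorphism `R_[v] : Out⁰(A_Γ) → Out(A_{J_[v]})`, which sends the class of
`φ` to the class of the restriction to `A_{J_[v]}` of the representative `φ_v`. -/
noncomputable def restrictionAt (c : MaxClass G) :
    pureOut G →* Out (special G (classJoin G c.1)) :=
  MonoidHom.mk' (fun x => outMk _ (restrictAut _ (rep G c x) (rep_mem_stab G c x))) (by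
    intro x y
    have h := mul_mem (rep_mem_stab G c x) (rep_mem_stab G c y)
    rw [outMk_restrict_eq G _ (rep_mem_stab G c (x * y)) h
      (by rw [map_mul, outMk_rep, outMk_rep, outMk_rep]; rfl), ← map_mul]
    rfl)

/-- The value of `R_[v]` can be computed from any representative that preserves `A_{J_[v]}`. -/
theorem restrictionAt_eq (c : MaxClass G) (x : pureOut G) (φ : MulAut (RAAG G))
    (hφ : φ ∈ stab (special G (classJoin G c.1))) (h : outMk (RAAG G) φ = x) :
    restrictionAt G c x = outMk _ (restrictAut _ φ hφ) :=
  outMk_restrict_eq G _ (rep_mem_stab G c x) hφ ((outMk_rep G c x).trans h.symm)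

/-- The restriction homomorphism `R = ∏ R_[v]`, over all maximal classes `[v]`. -/
noncomputable def restriction :
    pureOut G →* ((c : MaxClass G) → Out (special G (classJoin G c.1))) :=
  MonoidHom.pi (restrictionAt G)

end RAAG

/-! The kernel $K$ embeds in $\mathbb{Z}^\iota$ with $\iota$ finite, hence is free abelian of finite
rank. An element $k\in K$ has, for each maximal class $c$, a representative $\phi_c$ that is the
identity on $A_{J_c}$. Two of them differ by conjugation by some $t_{cd}$, which centralizes
$A_{J_c\cap J_d}$ and so lies in the special subgroup on the vertices whose stars contain $J_c\cap
J_d$ (`trans_mem`, resting on the centralizer computation `mem_special_star_of_commute`). If $c$ and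
$d$ are adjacent, these vertices form a clique, so exponents determine $t_{cd}$ (`eq_one_of_expo`).

The choice of $\phi_c$ is free up to the centralizer of $A_{J_c}$, which lies in $A_c$. Hence the
exponent of $x\notin c\cup d$ in $t_{cd}$ is independent of choices, and for $x\in c$ so is the
difference of the exponents in $t_{cd}$ and $t_{cd'}$. These numbers are homomorphisms on $K$
(`edgeHom`, `cornerHom`).

They are jointly injective (`eq_one_of_edgeHom_of_cornerHom`): if all vanish, the $\phi_c$ can be
corrected to agree on adjacent classes, hence on all classes because $\Gamma$ is connected. The
joins cover $V$, so the common automorphism is trivial. -/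

/-! ### Centralizers of free generators in free groups. -/

theorem FreeGroup.mem_zpowers_of_commute {α : Type*} (a : α) :
    ∀ (w : FreeGroup α), Commute w (FreeGroup.of a) →
      w ∈ Subgroup.zpowers (FreeGroup.of a) := by
  classical
  suffices H : ∀ (n : ℕ) (w : FreeGroup α), w.toWord.length = n → Commute w (FreeGroup.of a) →
      w ∈ Subgroup.zpowers (FreeGroup.of a) from fun w => H _ w rfl
  intro n
  induction n with
  | zero =>
    intro w hw _
    rw [List.length_eq_zero_iff, FreeGroup.toWord_eq_nil_iff] at hw
    exact hw ▸ one_mem _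
  | succ n ih =>
    intro w hw hc
    obtain ⟨⟨x, b⟩, L, hL⟩ : ∃ y L, w.toWord = y :: L := by
      cases h : w.toWord with
      | nil => simp [h] at hw
      | cons y L => exact ⟨y, L, rfl⟩
    have hred := FreeGroup.isReduced_toWord (x := w)
    rw [hL] at hw
    have hwL : w = FreeGroup.mk [(x, b)] * FreeGroup.mk L := by
      rw [FreeGroup.mul_mk, List.singleton_append, ← hL, FreeGroup.mk_toWord]
    by_cases hx : x = a
    · subst hx
      have hz : FreeGroup.mk [(x, b)] ∈ Subgroup.zpowers (FreeGroup.of x) := by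
        cases b
        · exact inv_mem (Subgroup.mem_zpowers (FreeGroup.of x))
        · exact Subgroup.mem_zpowers (FreeGroup.of x)
      have hzc : Commute (FreeGroup.mk [(x, b)]) (FreeGroup.of x) := by
        obtain ⟨k, hk⟩ := hz
        rw [← hk]
        exact (Commute.refl _).zpow_left k
      have hL' : FreeGroup.mk L = (FreeGroup.mk [(x, b)])⁻¹ * w := by
        rw [hwL, inv_mul_cancel_left]
      have hLred : (FreeGroup.mk L).toWord = L := by
        rw [FreeGroup.toWord_mk]
        apply FreeGroup.IsReduced.reduce_eq
        rw [hL] at hred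
        exact (List.isChain_cons.1 hred).2
      have := ih (FreeGroup.mk L) (by rw [hLred]; simpa using hw)
        (by rw [hL']; exact hzc.inv_left.mul_left hc)
      rw [hwL]
      exact mul_mem hz this
    · exfalso
      -- No cancellation occurs in `a * w`, so its word is one letter longer than that of `w`. The
      -- word of `w * a` is a sublist of `w` followed by `a`, of the same length, hence equal to it.
      -- The first letters then force `x = a`.
      have h1 : (FreeGroup.of a * w).toWord = (a, true) :: (x, b) :: L := by
        rw [FreeGroup.toWord_mul, FreeGroup.toWord_of, hL, List.singleton_append]
        apply FreeGroup.IsReduced.reduce_eq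
        rw [hL] at hred
        exact List.isChain_cons_cons.2 ⟨fun h => absurd h.symm hx, hred⟩
      have h2 := FreeGroup.toWord_mul_sublist w (FreeGroup.of a)
      rw [hc.eq, h1, hL, FreeGroup.toWord_of] at h2
      have h3 := h2.eq_of_length (by simp)
      rw [List.cons_append, List.cons.injEq] at h3
      exact hx (congrArg Prod.fst h3.1).symm

/-! ### Special subgroups, their intersections, centralizers and exponent sums. -/

namespace RAAG

variable {V : Type*} (G : SimpleGraph V)

/-- The homomorphism from `A_Γ` given by a map on vertices that respects the relations. -/
def lift {H : Type*} [Group H] (f : V → H) (hf : ∀ a b, G.Adj a b → Commute (f a) (f b)) :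
    RAAG G →* H :=
  PresentedGroup.toGroup (f := f) (by
    rintro _ ⟨a, b, hab, rfl⟩
    rw [map_mul, map_mul, map_mul, map_inv, map_inv, FreeGroup.lift_apply_of,
      FreeGroup.lift_apply_of, mul_inv_eq_one, mul_inv_eq_iff_eq_mul]
    exact hf a b hab)

theorem lift_gen {H : Type*} [Group H] (f : V → H) (hf : ∀ a b, G.Adj a b → Commute (f a) (f b))
    (v : V) : lift G f hf (gen G v) = f v :=
  PresentedGroup.toGroup.of _

variable {G} in
theorem hom_ext {H : Type*} [Group H] {f g : RAAG G →* H}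
    (h : ∀ v, f (gen G v) = g (gen G v)) : f = g :=
  PresentedGroup.ext h

theorem special_univ : special G Set.univ = ⊤ := by
  rw [special, Set.image_univ]
  exact PresentedGroup.closure_range_of _

theorem special_mono {S T : Set V} (h : S ⊆ T) : special G S ≤ special G T :=
  Subgroup.closure_mono (Set.image_mono h)

open Classical in
/-- The endomorphism of `A_Γ` that kills the generators outside `S`. -/
noncomputable def kill (S : Set V) : RAAG G →* RAAG G :=
  lift G (fun v => if v ∈ S then gen G v else 1) (by
    intro a b hab
    by_cases ha : a ∈ S <;> by_cases hb : b ∈ S <;> simp [ha, hb]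
    exact gen_comm G hab)

open Classical in
theorem kill_gen (S : Set V) (v : V) : kill G S (gen G v) = if v ∈ S then gen G v else 1 :=
  lift_gen G _ _ v

theorem kill_eq_self {S : Set V} {g : RAAG G} (hg : g ∈ special G S) : kill G S g = g := by
  induction hg using Subgroup.closure_induction with
  | mem x hx =>
    obtain ⟨u, hu, rfl⟩ := hx
    rw [kill_gen, if_pos hu]
  | one => exact map_one _
  | mul x y _ _ hx hy => rw [map_mul, hx, hy]
  | inv x _ hx => rw [map_inv, hx]

theorem kill_mem (S : Set V) {T : Set V} {g : RAAG G} (hg : g ∈ special G T) :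
    kill G S g ∈ special G (S ∩ T) := by
  induction hg using Subgroup.closure_induction with
  | mem x hx =>
    obtain ⟨u, hu, rfl⟩ := hx
    rw [kill_gen]
    split_ifs with h
    · exact gen_mem G ⟨h, hu⟩
    · exact one_mem _
  | one => rw [map_one]; exact one_mem _
  | mul x y _ _ hx hy => rw [map_mul]; exact mul_mem hx hy
  | inv x _ hx => rw [map_inv]; exact inv_mem hx

/-- The retraction `kill G S` fixes `g` and maps $A_T$ into $A_{S\cap T}$. -/
theorem mem_special_inter {S T : Set V} {g : RAAG G} (hS : g ∈ special G S)
    (hT : g ∈ special G T) : g ∈ special G (S ∩ T) := by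
  rw [← kill_eq_self G hS]
  exact kill_mem G S hT

theorem mem_special_biInter {ι : Type*} {T : Set ι} (hT : T.Finite) (S : ι → Set V) {g : RAAG G}
    (h : ∀ t ∈ T, g ∈ special G (S t)) : g ∈ special G (⋂ t ∈ T, S t) := by
  induction T, hT using Set.Finite.induction_on with
  | empty => simp [special_univ]
  | insert _ _ ih =>
    rw [Set.biInter_insert]
    exact mem_special_inter G (h _ (Set.mem_insert _ _))
      (ih fun t ht => h t (Set.mem_insert_of_mem _ ht))

/-- An element commuting with the given generators commutes with the subgroup they generate. -/
theorem commute_of_mem_special {S : Set V} {x g : RAAG G} (h : ∀ s ∈ S, Commute x (gen G s))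
    (hg : g ∈ special G S) : Commute x g := by
  induction hg using Subgroup.closure_induction with
  | mem y hy =>
    obtain ⟨u, hu, rfl⟩ := hy
    exact h u hu
  | one => exact Commute.one_right _
  | mul y z _ _ hy hz => exact hy.mul_right hz
  | inv y _ hy => exact hy.inv_right

/-- Translation of the free generators of the free group on the cosets of a subgroup. -/
def cosetAction {A : Type*} [Group A] (L : Subgroup A) : A →* MulAut (FreeGroup (A ⧸ L)) :=
  MonoidHom.mk' (fun h => FreeGroup.freeGroupCongr (MulAction.toPerm h)) (by
    intro a b
    refine MulEquiv.toMonoidHom_injective (FreeGroup.ext_hom _ _ fun x => ?_)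
    simp [mul_smul])

theorem cosetAction_of {A : Type*} [Group A] (L : Subgroup A) (h : A) (x : A ⧸ L) :
    cosetAction L h (FreeGroup.of x) = FreeGroup.of (h • x) := by
  simp [cosetAction]

/-- The centralizer of a generator lies in the subgroup generated by its star. -/
theorem mem_special_star_of_commute {v : V} {g : RAAG G} (hg : Commute g (gen G v)) :
    g ∈ special G (star G v) := by
  classical
  set L : Subgroup (RAAG G) := special G (G.neighborSet v)
  let e : RAAG G ⧸ L := ((1 : RAAG G) : RAAG G ⧸ L)
  let θ := cosetAction L
  -- `A_Γ` is a retract of the semidirect product of a free group on cosets with `A_Γ`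
  let Φ : RAAG G →* FreeGroup (RAAG G ⧸ L) ⋊[θ] RAAG G :=
    lift G (fun u => if u = v then SemidirectProduct.inl (FreeGroup.of e)
      else SemidirectProduct.inr (gen G u)) (by
      have key : ∀ b, G.Adj v b → Commute (SemidirectProduct.inl (FreeGroup.of e) :
          FreeGroup (RAAG G ⧸ L) ⋊[θ] RAAG G) (SemidirectProduct.inr (gen G b)) := by
        intro b hb
        have hbe : gen G b • e = e := by
          change ((gen G b * 1 : RAAG G) : RAAG G ⧸ L) = _
          rw [mul_one]
          exact QuotientGroup.eq.2 (by rw [mul_one]; exact inv_mem (gen_mem G hb))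
        have h1 := SemidirectProduct.inl_aut (φ := θ) (gen G b) (FreeGroup.of e)
        rw [cosetAction_of, hbe, map_inv, eq_mul_inv_iff_mul_eq] at h1
        exact h1
      intro a b hab
      by_cases ha : a = v
      · subst ha
        rw [if_pos rfl, if_neg hab.ne']
        exact key b hab
      · rw [if_neg ha]
        by_cases hb : b = v
        · subst hb
          rw [if_pos rfl]
          exact (key a hab.symm).symm
        · rw [if_neg hb]
          exact (show Commute (gen G a) (gen G b) from gen_comm G hab).map _)
  -- The free generator of the coset $hL$ goes back to $hvh^{-1}$; this is well defined because $L$,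
  -- generated by the link of `v`, commutes with `v`.
  let conjv : RAAG G ⧸ L → RAAG G := fun x => Quotient.liftOn' x
    (fun h => h * gen G v * h⁻¹) (by
      intro a b hab
      rw [QuotientGroup.leftRel_apply] at hab
      have h1 : Commute (gen G v) (a⁻¹ * b) :=
        commute_of_mem_special G (fun s hs => gen_comm G hs) hab
      have h2 : b = a * (a⁻¹ * b) := by group
      change a * gen G v * a⁻¹ = b * gen G v * b⁻¹
      rw [h2, mul_assoc a (a⁻¹ * b), ← h1.eq]
      group)
  have hconjv : ∀ h : RAAG G, conjv (h : RAAG G ⧸ L) = h * gen G v * h⁻¹ := fun h => rfl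
  let Ψ : FreeGroup (RAAG G ⧸ L) ⋊[θ] RAAG G →* RAAG G :=
    SemidirectProduct.lift (FreeGroup.lift conjv) (MonoidHom.id _) (by
      intro h
      refine FreeGroup.ext_hom _ _ fun x => ?_
      induction x using QuotientGroup.induction_on with
      | H x =>
      simp only [MonoidHom.comp_apply, MulEquiv.coe_toMonoidHom, θ]
      rw [cosetAction_of, FreeGroup.lift_apply_of, FreeGroup.lift_apply_of]
      change conjv ((h * x : RAAG G) : RAAG G ⧸ L) = _
      rw [hconjv, hconjv]
      simp only [MonoidHom.id_apply, MulAut.conj_apply]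
      group)
  have hΨΦ : ∀ g, Ψ (Φ g) = g := by
    have : Ψ.comp Φ = MonoidHom.id _ := hom_ext fun u => by
      simp only [MonoidHom.comp_apply, Φ, Ψ, lift_gen, MonoidHom.id_apply]
      split_ifs with hu
      · rw [SemidirectProduct.lift_inl, FreeGroup.lift_apply_of, hu]
        simp [e, hconjv]
      · rw [SemidirectProduct.lift_inr]
        rfl
    exact fun g => DFunLike.congr_fun this g
  have hΦv : Φ (gen G v) = SemidirectProduct.inl (FreeGroup.of e) := by
    simp only [Φ, lift_gen, if_pos]
  have hc := (hg.map Φ).eq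
  rw [hΦv] at hc
  have hc1 := congrArg SemidirectProduct.left hc
  rw [SemidirectProduct.mul_left, SemidirectProduct.mul_left, SemidirectProduct.left_inl,
    SemidirectProduct.right_inl, map_one, MulAut.one_apply, cosetAction_of] at hc1
  -- Counting occurrences of the generator `e` on both sides of `hc1` gives a contradiction unless
  -- the translated generator is `e` itself.
  have hfix : (Φ g).right • e = e := by
    by_contra hne
    have := congrArg (FreeGroup.lift
      (fun x => Multiplicative.ofAdd (if x = e then (1 : ℤ) else 0))) hc1
    rw [map_mul, map_mul, mul_comm, FreeGroup.lift_apply_of, FreeGroup.lift_apply_of] at this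
    rw [if_neg hne, if_pos rfl, mul_right_cancel_iff] at this
    exact absurd (Multiplicative.ofAdd.injective this) (by norm_num)
  rw [hfix] at hc1
  obtain ⟨k, hk⟩ := FreeGroup.mem_zpowers_of_commute e _ hc1
  -- The stabilizer of the base coset `e` is `L`.
  have hr : (Φ g).right ∈ L := by
    have : (((Φ g).right * 1 : RAAG G) : RAAG G ⧸ L) = ((1 : RAAG G) : RAAG G ⧸ L) := hfix
    rw [mul_one] at this
    simpa using QuotientGroup.eq.1 this
  have hfinal : g = gen G v ^ k * (Φ g).right := by
    conv_lhs => rw [← hΨΦ g, ← SemidirectProduct.inl_left_mul_inr_right (Φ g), ← hk]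
    simp only [map_mul, map_zpow, Ψ, SemidirectProduct.lift_inl, SemidirectProduct.lift_inr,
      FreeGroup.lift_apply_of, MonoidHom.id_apply]
    simp [e, hconjv]
  rw [hfinal]
  exact mul_mem (zpow_mem (gen_mem G (Or.inl rfl)) k)
    (special_mono G (Set.subset_insert _ _) hr)

theorem mem_special_of_commute [Finite V] {T : Set V} {g : RAAG G}
    (h : ∀ t ∈ T, Commute g (gen G t)) : g ∈ special G (⋂ t ∈ T, star G t) :=
  mem_special_biInter G T.toFinite _ fun t ht => mem_special_star_of_commute G (h t ht)

open Classical in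
/-- The exponent sum of the generator `x`. -/
noncomputable def expo (x : V) : RAAG G →* Multiplicative ℤ :=
  lift G (fun u => Multiplicative.ofAdd (if u = x then 1 else 0)) fun _ _ _ => Commute.all _ _

open Classical in
theorem expo_gen (x u : V) :
    expo G x (gen G u) = Multiplicative.ofAdd (if u = x then (1 : ℤ) else 0) :=
  lift_gen G _ _ u

theorem expo_eq_one {x : V} {S : Set V} (hx : x ∉ S) {g : RAAG G} (hg : g ∈ special G S) :
    expo G x g = 1 := by
  induction hg using Subgroup.closure_induction with
  | mem y hy =>
    obtain ⟨u, hu, rfl⟩ := hy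
    rw [expo_gen, if_neg (by rintro rfl; exact hx hu)]
    rfl
  | one => exact map_one _
  | mul y z _ _ hy hz => rw [map_mul, hy, hz, one_mul]
  | inv y _ hy => rw [map_inv, hy, inv_one]

/-- An element of the free abelian subgroup given by a clique is determined by its exponents. -/
theorem eq_one_of_expo [Finite V] {S : Set V} (hS : S.Pairwise G.Adj) {g : RAAG G}
    (hg : g ∈ special G S) (h : ∀ x ∈ S, expo G x g = 1) : g = 1 := by
  classical
  induction S, S.toFinite using Set.Finite.induction_on generalizing g with
  | empty => simpa [special] using hg
  | @insert a S haS _ ih =>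
    -- In a clique `a` commutes with $A_S$, so its powers can be collected in front; the exponent of
    -- `a` then reads off `k`.
    obtain ⟨k, s, hs, rfl⟩ : ∃ (k : ℤ), ∃ s ∈ special G S, g = gen G a ^ k * s := by
      have hcomm : ∀ s ∈ special G S, Commute (gen G a) s := fun s hs =>
        commute_of_mem_special G (fun u hu => gen_comm G
          (hS (Set.mem_insert _ _) (Set.mem_insert_of_mem _ hu) (fun h => haS (h ▸ hu)))) hs
      clear h
      induction hg using Subgroup.closure_induction with
      | mem x hx =>
        obtain ⟨u, hu | hu, rfl⟩ := hx
        · exact ⟨1, 1, one_mem _, by rw [hu]; simp⟩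
        · exact ⟨0, _, gen_mem G hu, by simp⟩
      | one => exact ⟨0, 1, one_mem _, by simp⟩
      | mul x y _ _ hx hy =>
        obtain ⟨k, s, hs, rfl⟩ := hx
        obtain ⟨l, t, ht, rfl⟩ := hy
        refine ⟨k + l, s * t, mul_mem hs ht, ?_⟩
        rw [zpow_add, mul_assoc, ← mul_assoc s, ← ((hcomm s hs).zpow_left l).eq]
        simp only [mul_assoc]
      | inv x _ hx =>
        obtain ⟨k, s, hs, rfl⟩ := hx
        refine ⟨-k, s⁻¹, inv_mem hs, ?_⟩
        rw [mul_inv_rev, zpow_neg, (((hcomm s hs).zpow_left k).inv_inv).eq]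
    have hk : k = 0 := by
      have := h a (Set.mem_insert _ _)
      rw [map_mul, map_zpow, expo_eq_one G haS hs, mul_one, expo_gen, if_pos rfl,
        ← ofAdd_zsmul] at this
      simpa using this
    subst hk
    rw [zpow_zero, one_mul]
    refine ih (hS.mono (Set.subset_insert _ _)) hs fun x hx => ?_
    have := h x (Set.mem_insert_of_mem _ hx)
    rwa [zpow_zero, one_mul] at this

end RAAG

/-! ### Combinatorics of maximal classes and their joins. -/

namespace RAAG

variable {V : Type*} (G : SimpleGraph V)

/-- The vertices whose star contains `T`. -/
def apexes (T : Set V) : Set V := ⋂ t ∈ T, star G t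

variable {G}

theorem mem_star_comm {u v : V} : u ∈ star G v ↔ v ∈ star G u := by
  constructor <;>
  · rintro (rfl | h)
    · exact Or.inl rfl
    · exact Or.inr (SimpleGraph.Adj.symm h)

theorem mem_apexes {T : Set V} {x : V} : x ∈ apexes G T ↔ ∀ t ∈ T, x ∈ star G t := by
  simp [apexes]

theorem commute_gen_of_mem_star {x t : V} (h : x ∈ star G t) : Commute (gen G x) (gen G t) := by
  rcases h with rfl | h
  · exact Commute.refl _
  · exact (gen_comm G h).symm

theorem commute_of_mem_special_apexes {T : Set V} {g : RAAG G} (hg : g ∈ special G (apexes G T)) :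
    ∀ t ∈ T, Commute g (gen G t) := fun _ ht =>
  (commute_of_mem_special G
    (fun _ hs => (commute_gen_of_mem_star (mem_apexes.1 hs _ ht)).symm) hg).symm

theorem Dom.refl (v : V) : Dom G v v := fun _ h => Or.inr h

theorem mem_cls_self (v : V) : v ∈ cls G v := ⟨Dom.refl v, Dom.refl v⟩

theorem cls_eq_of_mem {u v : V} (h : u ∈ cls G v) : cls G u = cls G v := by
  ext w
  exact ⟨fun hw => ⟨h.1.trans hw.1, hw.2.trans h.2⟩, fun hw => ⟨h.2.trans hw.1, hw.2.trans h.1⟩⟩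

namespace MaxClass

theorem eq_cls (c : MaxClass G) {v : V} (h : v ∈ c.1) : c.1 = cls G v := by
  obtain ⟨c, u, hu, rfl⟩ := c
  exact (cls_eq_of_mem h).symm

theorem isMax (c : MaxClass G) {v : V} (h : v ∈ c.1) : IsMaxVertex G v := by
  obtain ⟨c, u, hu, rfl⟩ := c
  exact fun w hw => (hu w (h.1.trans hw)).trans h.1

theorem nonempty (c : MaxClass G) : c.1.Nonempty := by
  obtain ⟨c, u, hu, rfl⟩ := c
  exact ⟨u, mem_cls_self u⟩

theorem eq_of_mem {c d : MaxClass G} {v : V} (hc : v ∈ c.1) (hd : v ∈ d.1) : c = d :=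
  Subtype.ext ((c.eq_cls hc).trans (d.eq_cls hd).symm)

theorem star_subset (c : MaxClass G) {v : V} (h : v ∈ c.1) : star G v ⊆ classJoin G c.1 := by
  rintro w (rfl | hw)
  · exact Or.inr h
  · by_cases hwc : w ∈ c.1
    · exact Or.inr hwc
    · exact Or.inl ⟨hwc, v, h, hw⟩

/-- An apex dominates every vertex of `c`, so maximality puts it in `c`. Consequently the
centralizer of $A_{J_c}$ lies in $A_c$. -/
theorem apexes_join_subset (c : MaxClass G) : apexes G (classJoin G c.1) ⊆ c.1 := by
  intro x hx
  obtain ⟨v, hv⟩ := c.nonempty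
  have hle : Dom G v x := fun t ht =>
    mem_star_comm.1 (mem_apexes.1 hx t (c.star_subset hv (Or.inr ht)))
  rw [c.eq_cls hv]
  exact ⟨hle, c.isMax hv x hle⟩

/-- Two distinct maximal classes are adjacent if they have adjacent representatives. -/
def Adj (c d : MaxClass G) : Prop := c ≠ d ∧ ∃ v ∈ c.1, ∃ w ∈ d.1, G.Adj v w

theorem Adj.symm {c d : MaxClass G} (h : c.Adj d) : d.Adj c := by
  obtain ⟨hne, v, hv, w, hw, hvw⟩ := h
  exact ⟨hne.symm, w, hw, v, hv, hvw.symm⟩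

theorem Adj.subset_join {c d : MaxClass G} (h : c.Adj d) : c.1 ⊆ classJoin G d.1 := by
  obtain ⟨hne, v, hv, w, hw, hvw⟩ := h
  intro u hu
  rw [c.eq_cls hv] at hu
  exact d.star_subset hw (mem_star_comm.1 (hu.1 hvw))

/-- The apexes of the intersection of the joins of adjacent classes form a clique. -/
theorem Adj.pairwise_apexes {c d : MaxClass G} (h : c.Adj d) :
    (apexes G (classJoin G c.1 ∩ classJoin G d.1)).Pairwise G.Adj := by
  intro x hx y hy hxy
  have hxT : x ∈ classJoin G c.1 ∩ classJoin G d.1 := by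
    obtain ⟨v, hv⟩ := c.nonempty
    obtain ⟨w, hw⟩ := d.nonempty
    exact ⟨c.star_subset hv (mem_apexes.1 hx v ⟨Or.inr hv, h.subset_join hv⟩),
      d.star_subset hw (mem_apexes.1 hx w ⟨h.symm.subset_join hw, Or.inr hw⟩)⟩
  rcases mem_apexes.1 hy x hxT with rfl | h
  · exact absurd rfl hxy
  · exact h

/-- Vertices of $L_c$ are adjacent to all of `c`, and `c` itself lies in $J_c\cap J_d$. Thus the
`c`-part of a comparison element still centralizes $A_{J_c}$ and may be used to correct the
representative at `c`. -/
theorem Adj.inter_apexes_subset {c d : MaxClass G} (h : c.Adj d) :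
    c.1 ∩ apexes G (classJoin G c.1 ∩ classJoin G d.1) ⊆ apexes G (classJoin G c.1) := by
  rintro x ⟨hxc, hx⟩
  rw [mem_apexes]
  rintro t (⟨-, u, hu, htu⟩ | ht)
  · rw [c.eq_cls hu] at hxc
    exact mem_star_comm.1 (hxc.1 htu)
  · exact mem_apexes.1 hx t ⟨Or.inr ht, h.subset_join ht⟩

theorem exists_dom [Finite V] (v : V) : ∃ m, IsMaxVertex G m ∧ Dom G v m := by
  let _ : Preorder V :=
    { le := Dom G, le_refl := Dom.refl, le_trans := fun _ _ _ h h' => Dom.trans h h' }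
  obtain ⟨m, hvm, hm⟩ := Set.Finite.exists_le_maximal (s := Set.univ) (Set.toFinite _)
    (Set.mem_univ v)
  exact ⟨m, fun w hw => hm.2 (Set.mem_univ w) hw, hvm⟩

theorem exists_dominating_class [Finite V] (v : V) :
    ∃ c : MaxClass G, ∃ m ∈ c.1, Dom G v m := by
  obtain ⟨m, hm, hvm⟩ := exists_dom (G := G) v
  exact ⟨⟨cls G m, m, hm, rfl⟩, m, mem_cls_self m, hvm⟩

/-- Domination moves the edge `u u'` to `m u'` and then to `m m'`; if an edge degenerates on the
way, the two classes coincide. -/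
theorem eq_or_adj {c d : MaxClass G} {u u' m m' : V} (huu : G.Adj u u') (hm : m ∈ c.1)
    (hm' : m' ∈ d.1) (hum : Dom G u m) (hum' : Dom G u' m') : c = d ∨ c.Adj d := by
  by_cases hcd : c = d
  · exact Or.inl hcd
  refine Or.inr ⟨hcd, ?_⟩
  have hd : ∀ {x}, Dom G m x → x ∈ c.1 := fun {x} h => by
    rw [c.eq_cls hm]
    exact ⟨h, c.isMax hm x h⟩
  rcases hum huu with rfl | h
  · exact absurd (eq_of_mem (hd hum') hm') hcd
  · rcases hum' (SimpleGraph.Adj.symm h) with rfl | h'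
    · exact absurd (eq_of_mem hm hm') hcd
    · exact ⟨m, hm, m', hm', SimpleGraph.Adj.symm h'⟩

/-- A path in $\Gamma$ is projected to maximal classes by sending each vertex to a class dominating
it; vertices of a maximal class go to that class. -/
theorem reflTransGen_adj [Finite V] (hG : G.Connected) (c d : MaxClass G) :
    Relation.ReflTransGen Adj c d := by
  choose f m hm hdom using exists_dominating_class (G := G)
  have hf : ∀ {c : MaxClass G} {v : V}, v ∈ c.1 → f v = c := fun {c v} hv =>
    eq_of_mem (hm v) (by
      rw [c.eq_cls hv]
      exact ⟨hdom v, c.isMax hv _ (hdom v)⟩)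
  obtain ⟨v, hv⟩ := c.nonempty
  obtain ⟨w, hw⟩ := d.nonempty
  rw [← hf hv, ← hf hw]
  obtain ⟨p⟩ := hG.preconnected v w
  clear hv hw
  induction p with
  | nil => exact .refl
  | @cons a b _ hab _ ih =>
    rcases eq_or_adj hab (hm a) (hm b) (hdom a) (hdom b) with h | h
    · rwa [h]
    · exact .head h ih

/-- A vertex with a neighbour `x` lies in the star of any maximal vertex dominating `x`. Without
neighbours, connectedness leaves `u` as the only vertex. -/
theorem exists_mem_join [Finite V] (hG : G.Connected) (u : V) :
    ∃ c : MaxClass G, u ∈ classJoin G c.1 := by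
  obtain ⟨c, m, hm, hum⟩ := exists_dominating_class (G := G) u
  by_cases hx : ∃ x, G.Adj u x
  · obtain ⟨x, hx⟩ := hx
    obtain ⟨d, n, hn, hxn⟩ := exists_dominating_class (G := G) x
    exact ⟨d, d.star_subset hn (hxn hx.symm)⟩
  · obtain ⟨p⟩ := hG.preconnected u m
    cases p with
    | nil => exact ⟨c, Or.inr hm⟩
    | cons h _ => exact absurd ⟨_, h⟩ hx

end MaxClass

end RAAG

/-- A group that embeds into a power `ℤ^ι` with `ι` finite is free abelian of finite rank. -/
theorem exists_mulEquiv_of_injective {K ι : Type*} [Group K] [Finite ι]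
    (f : K →* (ι → Multiplicative ℤ)) (hf : Function.Injective f) :
    ∃ n : ℕ, Nonempty (K ≃* Multiplicative (Fin n → ℤ)) := by
  let e : (ι → Multiplicative ℤ) ≃* Multiplicative (ι → ℤ) :=
    { toFun := fun a => Multiplicative.ofAdd fun i => (a i).toAdd
      invFun := fun a i => Multiplicative.ofAdd (a.toAdd i)
      left_inv := fun _ => rfl
      right_inv := fun _ => rfl
      map_mul' := fun _ _ => rfl }
  let f' : Additive K →+ (ι → ℤ) := MonoidHom.toAdditiveLeft (e.toMonoidHom.comp f)
  have hf' : Function.Injective f' := e.injective.comp hf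
  obtain ⟨n, ⟨b⟩⟩ := Submodule.nonempty_basis_of_pid (Pi.basisFun ℤ ι)
    (AddSubgroup.toIntSubmodule f'.range)
  refine ⟨n, ⟨?_⟩⟩
  let e₁ : Additive K ≃+ f'.range := AddMonoidHom.ofInjective hf'
  exact AddEquiv.toMultiplicativeRight (e₁.trans b.equivFun.toAddEquiv)

/-! ### Representatives of kernel elements and their comparison. -/

namespace RAAG

variable {V : Type*} {G : SimpleGraph V}

theorem expo_kill {S : Set V} {x : V} (hx : x ∈ S) (g : RAAG G) :
    expo G x (kill G S g) = expo G x g := by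
  classical
  refine DFunLike.congr_fun (f := (expo G x).comp (kill G S)) (hom_ext fun u => ?_) g
  rw [MonoidHom.comp_apply, kill_gen]
  by_cases hu : u ∈ S
  · rw [if_pos hu]
  · rw [if_neg hu, map_one, expo_gen, if_neg (by rintro rfl; exact hu hx)]
    rfl

/-- The automorphism fixes the generators in `T`. -/
def FixesOn (T : Set V) (φ : MulAut (RAAG G)) : Prop := ∀ u ∈ T, φ (gen G u) = gen G u

theorem FixesOn.apply_eq {T : Set V} {φ : MulAut (RAAG G)} (h : FixesOn T φ) {g : RAAG G}
    (hg : g ∈ special G T) : φ g = g := by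
  induction hg using Subgroup.closure_induction with
  | mem y hy =>
    obtain ⟨u, hu, rfl⟩ := hy
    exact h u hu
  | one => exact map_one _
  | mul y z _ _ hy hz => rw [map_mul, hy, hz]
  | inv y _ hy => rw [map_inv, hy]

theorem FixesOn.mul {T : Set V} {φ ψ : MulAut (RAAG G)} (hφ : FixesOn T φ) (hψ : FixesOn T ψ) :
    FixesOn T (φ * ψ) := fun u hu => by
  rw [MulAut.mul_apply, hψ u hu, hφ u hu]

theorem FixesOn.mono {S T : Set V} (h : S ⊆ T) {φ : MulAut (RAAG G)} (hφ : FixesOn T φ) :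
    FixesOn S φ := fun u hu => hφ u (h hu)

theorem fixesOn_conj {T : Set V} {z : RAAG G} (hz : ∀ t ∈ T, Commute z (gen G t)) :
    FixesOn T (MulAut.conj z) := fun u hu => by
  rw [MulAut.conj_apply, (hz u hu).eq, mul_inv_cancel_right]

theorem FixesOn.eq_one {φ : MulAut (RAAG G)} (h : FixesOn Set.univ φ) : φ = 1 :=
  MulEquiv.ext fun g => h.apply_eq (by rw [special_univ]; trivial)

theorem FixesOn.mem_special_apexes [Finite V] {T : Set V} {φ : MulAut (RAAG G)} {z : RAAG G}
    (hφ : FixesOn T φ) (hψ : FixesOn T (MulAut.conj z * φ)) : z ∈ special G (apexes G T) :=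
  mem_special_of_commute G fun t ht => by
    have h := hψ t ht
    rw [MulAut.mul_apply, hφ t ht, MulAut.conj_apply, mul_inv_eq_iff_eq_mul] at h
    exact h

theorem outMk_conj_mul (z : RAAG G) (φ : MulAut (RAAG G)) :
    outMk _ (MulAut.conj z * φ) = outMk _ φ := by
  have h : outMk (RAAG G) (MulAut.conj z) = 1 :=
    (QuotientGroup.eq_one_iff _).2 (MonoidHom.mem_range.2 ⟨z, rfl⟩)
  rw [map_mul, h, one_mul]

theorem exists_conj_mul_of_outMk_eq {φ ψ : MulAut (RAAG G)} (h : outMk _ φ = outMk _ ψ) :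
    ∃ z : RAAG G, ψ = MulAut.conj z * φ := by
  have h1 : outMk (RAAG G) (ψ * φ⁻¹) = 1 := by rw [map_mul, map_inv, h, mul_inv_cancel]
  obtain ⟨z, hz⟩ := (QuotientGroup.eq_one_iff _).1 h1
  exact ⟨z, by rw [hz, inv_mul_cancel_right]⟩

/-- Triviality in $Out(A_{J_c})$ means that the restriction is conjugation by an element of
$A_{J_c}$, which can be undone by an inner automorphism of $A_\Gamma$. -/
theorem exists_fixesOn_join (k : (restriction G).ker) (c : MaxClass G) :
    ∃ φ : MulAut (RAAG G), outMk _ φ = k.1 ∧ FixesOn (classJoin G c.1) φ := by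
  have h : restrictionAt G c k.1 = 1 := congrFun k.2 c
  obtain ⟨z, hz⟩ := (QuotientGroup.eq_one_iff _).1 h
  refine ⟨MulAut.conj (z : RAAG G)⁻¹ * rep G c k.1, ?_, fun u hu => ?_⟩
  · rw [outMk_conj_mul, outMk_rep]
  · have h1 : (z : RAAG G) * gen G u * (z : RAAG G)⁻¹ = rep G c k.1 (gen G u) :=
      congrArg Subtype.val (DFunLike.congr_fun hz
        (⟨gen G u, gen_mem G hu⟩ : special G (classJoin G c.1)))
    rw [MulAut.mul_apply, ← h1, MulAut.conj_apply]
    group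

/-- A representative of an element of the kernel that is the identity on `A_{J_c}`. -/
noncomputable def kerRep (k : (restriction G).ker) (c : MaxClass G) : MulAut (RAAG G) :=
  (exists_fixesOn_join k c).choose

theorem outMk_kerRep (k : (restriction G).ker) (c : MaxClass G) : outMk _ (kerRep k c) = k.1 :=
  (exists_fixesOn_join k c).choose_spec.1

theorem kerRep_fixesOn (k : (restriction G).ker) (c : MaxClass G) :
    FixesOn (classJoin G c.1) (kerRep k c) :=
  (exists_fixesOn_join k c).choose_spec.2

theorem exists_kerRep_eq (k : (restriction G).ker) (c d : MaxClass G) :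
    ∃ z : RAAG G, kerRep k d = MulAut.conj z * kerRep k c :=
  exists_conj_mul_of_outMk_eq ((outMk_kerRep k c).trans (outMk_kerRep k d).symm)

/-- An element whose conjugation compares the representatives for two maximal classes. -/
noncomputable def trans (k : (restriction G).ker) (c d : MaxClass G) : RAAG G :=
  (exists_kerRep_eq k c d).choose

theorem kerRep_eq (k : (restriction G).ker) (c d : MaxClass G) :
    kerRep k d = MulAut.conj (trans k c d) * kerRep k c :=
  (exists_kerRep_eq k c d).choose_spec

theorem trans_mem [Finite V] (k : (restriction G).ker) (c d : MaxClass G) :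
    trans k c d ∈ special G (apexes G (classJoin G c.1 ∩ classJoin G d.1)) :=
  ((kerRep_fixesOn k c).mono Set.inter_subset_left).mem_special_apexes
    (by rw [← kerRep_eq]; exact (kerRep_fixesOn k d).mono Set.inter_subset_right)

theorem expo_eq_one_of_mem_apexes {c : MaxClass G} {x : V} (hx : x ∉ c.1) {z : RAAG G}
    (hz : z ∈ special G (apexes G (classJoin G c.1))) : expo G x z = 1 :=
  expo_eq_one G (fun h => hx (c.apexes_join_subset h)) hz

/-- If there are at least two maximal classes, then all exponents of central elements vanish. -/
theorem expo_eq_of_conj_eq [Finite V] {c d : MaxClass G} (hcd : c ≠ d) {y z : RAAG G}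
    (h : MulAut.conj y = MulAut.conj z) (x : V) : expo G x y = expo G x z := by
  have hc : ∀ T : Set V, y * z⁻¹ ∈ special G (apexes G T) := fun T =>
    FixesOn.mem_special_apexes (φ := 1) (fun _ _ => rfl) (by
      rw [map_mul, map_inv, h, mul_inv_cancel, one_mul]
      exact fun _ _ => rfl)
  rw [← mul_inv_eq_one, ← map_inv, ← map_mul]
  -- The central element $yz^{-1}$ lies in both $A_c$ and $A_d$, and `x` is missing from at least
  -- one of the disjoint classes.
  by_cases hx : x ∈ c.1
  · exact expo_eq_one_of_mem_apexes (fun hd => hcd (MaxClass.eq_of_mem hx hd)) (hc _)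
  · exact expo_eq_one_of_mem_apexes hx (hc _)

theorem apexes_inter_subset_join {c d : MaxClass G} (h : c.Adj d) :
    apexes G (classJoin G c.1 ∩ classJoin G d.1) ⊆ classJoin G c.1 := fun x hx => by
  obtain ⟨v, hv⟩ := c.nonempty
  exact c.star_subset hv (mem_apexes.1 hx v ⟨Or.inr hv, h.subset_join hv⟩)

/-- Chosen representatives need not multiply, but the defect centralizes $A_{J_c}$, so exponents
outside `c` do not see it. -/
theorem exists_kerRep_mul [Finite V] (k l : (restriction G).ker) (c : MaxClass G) :
    ∃ z ∈ special G (apexes G (classJoin G c.1)),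
      kerRep (k * l) c = MulAut.conj z * (kerRep k c * kerRep l c) := by
  obtain ⟨z, hz⟩ := exists_conj_mul_of_outMk_eq (φ := kerRep k c * kerRep l c)
    (ψ := kerRep (k * l) c) (by rw [map_mul, outMk_kerRep, outMk_kerRep, outMk_kerRep]; rfl)
  exact ⟨z, ((kerRep_fixesOn k c).mul (kerRep_fixesOn l c)).mem_special_apexes
    (by rw [← hz]; exact kerRep_fixesOn _ c), hz⟩

/-- The exponents of the comparison elements are multiplicative up to a coboundary. -/
theorem expo_trans_mul [Finite V] (k l : (restriction G).ker) {c d : MaxClass G}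
    (h : c.Adj d) {y z : RAAG G}
    (hy : kerRep (k * l) c = MulAut.conj y * (kerRep k c * kerRep l c))
    (hz : kerRep (k * l) d = MulAut.conj z * (kerRep k d * kerRep l d)) (x : V) :
    expo G x (trans (k * l) c d) * expo G x y =
      expo G x z * (expo G x (trans k c d) * expo G x (trans l c d)) := by
  -- The comparison element lies in $A_{J_c}$, where `kerRep k c` is the identity.
  have hfix : kerRep k c * MulAut.conj (trans l c d) =
      MulAut.conj (trans l c d) * kerRep k c := by
    ext g
    simp only [MulAut.mul_apply, MulAut.conj_apply, map_mul, map_inv]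
    rw [(kerRep_fixesOn k c).apply_eq
      (special_mono G (apexes_inter_subset_join h) (trans_mem l c d))]
  have key : MulAut.conj (trans (k * l) c d * y) =
      MulAut.conj (z * (trans k c d * trans l c d)) := by
    have h1 := kerRep_eq (k * l) c d
    rw [hz, hy, kerRep_eq k c d, kerRep_eq l c d,
      show MulAut.conj (trans k c d) * kerRep k c * (MulAut.conj (trans l c d) * kerRep l c) =
        MulAut.conj (trans k c d) * (kerRep k c * MulAut.conj (trans l c d)) * kerRep l c by
        simp only [mul_assoc], hfix] at h1
    rw [← mul_left_inj (kerRep k c * kerRep l c)]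
    simpa only [map_mul, mul_assoc] using h1.symm
  simpa only [map_mul] using expo_eq_of_conj_eq h.1 key x

/-! ### The exponent homomorphisms and their joint injectivity. -/

/-- The exponent of `x` in the element comparing two adjacent classes not containing `x`. -/
noncomputable def edgeHom [Finite V] {c d : MaxClass G} (h : c.Adj d) {x : V} (hc : x ∉ c.1)
    (hd : x ∉ d.1) : (restriction G).ker →* Multiplicative ℤ :=
  MonoidHom.mk' (fun k => expo G x (trans k c d)) (by
    intro k l
    obtain ⟨y, hy, hy'⟩ := exists_kerRep_mul k l c
    obtain ⟨z, hz, hz'⟩ := exists_kerRep_mul k l d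
    have := expo_trans_mul k l h hy' hz' x
    rwa [expo_eq_one_of_mem_apexes hc hy, expo_eq_one_of_mem_apexes hd hz, mul_one,
      one_mul] at this)

/-- The difference of the exponents of `x ∈ c` in the elements comparing `c` to two adjacent
classes. -/
noncomputable def cornerHom [Finite V] {c d d' : MaxClass G} (h : c.Adj d) (h' : c.Adj d') {x : V}
    (hc : x ∈ c.1) : (restriction G).ker →* Multiplicative ℤ :=
  MonoidHom.mk' (fun k => expo G x (trans k c d) / expo G x (trans k c d')) (by
    intro k l
    obtain ⟨y, hy, hy'⟩ := exists_kerRep_mul k l c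
    -- The defect `y` at `c` is the same for every neighbour `e`, so it cancels in the quotient; the
    -- defect at `e` has no `x`-exponent since `x ∉ e`.
    have key : ∀ e, c.Adj e → expo G x (trans (k * l) c e) =
        expo G x (trans k c e) * expo G x (trans l c e) / expo G x y := by
      intro e he
      obtain ⟨z, hz, hz'⟩ := exists_kerRep_mul k l e
      have := expo_trans_mul k l he hy' hz' x
      rw [expo_eq_one_of_mem_apexes (fun hx => he.1 (MaxClass.eq_of_mem hc hx)) hz,
        one_mul] at this
      exact eq_div_of_mul_eq' this
    rw [key d h, key d' h', div_div_div_cancel_right, mul_div_mul_comm])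

/-- The `c`-part of one comparison element serves all neighbours of `c`, since vanishing corners say
that the exponents in `c` do not depend on the neighbour. -/
theorem exists_correction [Finite V] {k : (restriction G).ker}
    (hcorner : ∀ {c d d' : MaxClass G} (h : c.Adj d) (h' : c.Adj d') {x : V} (hc : x ∈ c.1),
      cornerHom h h' hc k = 1) (c : MaxClass G) :
    ∃ z ∈ special G (apexes G (classJoin G c.1)),
      ∀ d, c.Adj d → ∀ x ∈ c.1, expo G x z = expo G x (trans k c d) := by
  by_cases h : ∃ d, c.Adj d
  · obtain ⟨d, hd⟩ := h
    refine ⟨kill G c.1 (trans k c d), special_mono G hd.inter_apexes_subset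
      (kill_mem G c.1 (trans_mem k c d)), fun e he x hx => ?_⟩
    rw [expo_kill hx]
    exact div_eq_one.1 (hcorner hd he hx)
  · exact ⟨1, one_mem _, fun d hd => absurd ⟨d, hd⟩ h⟩

theorem eq_one_of_edgeHom_of_cornerHom [Finite V] (hG : G.Connected) {k : (restriction G).ker}
    (hedge : ∀ {c d : MaxClass G} (h : c.Adj d) {x : V} (hc : x ∉ c.1) (hd : x ∉ d.1),
      edgeHom h hc hd k = 1)
    (hcorner : ∀ {c d d' : MaxClass G} (h : c.Adj d) (h' : c.Adj d') {x : V} (hc : x ∈ c.1),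
      cornerHom h h' hc k = 1) : k = 1 := by
  choose z hz hexp using exists_correction hcorner
  let φ : MaxClass G → MulAut (RAAG G) := fun c => MulAut.conj (z c) * kerRep k c
  have hφ : ∀ c, FixesOn (classJoin G c.1) (φ c) := fun c =>
    (fixesOn_conj (commute_of_mem_special_apexes (hz c))).mul (kerRep_fixesOn k c)
  have hadj : ∀ {c d : MaxClass G}, c.Adj d → φ c = φ d := by
    intro c d h
    have hd : φ d = MulAut.conj (z d * trans k c d * (z c)⁻¹) * φ c := by
      simp only [φ]
      rw [kerRep_eq k c d]
      simp only [map_mul, map_inv, mul_assoc, inv_mul_cancel_left]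
    have hmem := ((hφ c).mono (Set.inter_subset_left (t := classJoin G d.1))).mem_special_apexes
      (by rw [← hd]; exact (hφ d).mono Set.inter_subset_right)
    -- This element compares the corrected representatives and lives over a clique, so exponents
    -- suffice: those in `c` and `d` are cancelled by the corrections, the others vanish by `hedge`.
    have hone : z d * trans k c d * (z c)⁻¹ = 1 := by
      refine eq_one_of_expo G h.pairwise_apexes hmem fun x _ => ?_
      rw [map_mul, map_mul, map_inv]
      by_cases hxc : x ∈ c.1
      · rw [expo_eq_one_of_mem_apexes (fun hx => h.1 (MaxClass.eq_of_mem hxc hx)) (hz d),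
          hexp c d h x hxc, one_mul, mul_inv_cancel]
      · rw [expo_eq_one_of_mem_apexes hxc (hz c), inv_one, mul_one]
        by_cases hxd : x ∈ d.1
        -- The independently chosen `trans k d c` and `trans k c d` are inverse only modulo the
        -- centre, which has zero exponents.
        · rw [hexp d c h.symm x hxd, ← map_mul, ← map_one (expo G x)]
          refine expo_eq_of_conj_eq h.1 ?_ x
          have h1 := kerRep_eq k d c
          rw [kerRep_eq k c d, ← mul_assoc, ← map_mul, right_eq_mul] at h1
          rw [h1, map_one]
        · rw [expo_eq_one_of_mem_apexes hxd (hz d), one_mul]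
          exact hedge h hxc hxd
    rw [hd, hone, map_one, one_mul]
  have heq : ∀ c d, φ c = φ d := fun c d => by
    induction MaxClass.reflTransGen_adj hG c d with
    | refl => rfl
    | tail _ h ih => exact ih.trans (hadj h)
  obtain ⟨v⟩ := hG.nonempty
  obtain ⟨c, -⟩ := MaxClass.exists_mem_join hG v
  have hone : φ c = 1 := FixesOn.eq_one fun u _ => by
    obtain ⟨d, hd⟩ := MaxClass.exists_mem_join hG u
    rw [heq c d]
    exact hφ d u hd
  have hk : outMk _ (φ c) = k.1 := by rw [outMk_conj_mul, outMk_kerRep]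
  rw [hone, map_one] at hk
  exact Subtype.ext (Subtype.ext hk.symm)

end RAAG

theorem theoremK {V : Type*} [Finite V] (G : SimpleGraph V) (hG : G.Connected) :
    ∃ n : ℕ, Nonempty ((RAAG.restriction G).ker ≃* Multiplicative (Fin n → ℤ)) := by
  let I := RAAG.MaxClass G
  have : Finite I := Subtype.finite
  let E := {p : I × I × V // p.1.Adj p.2.1 ∧ p.2.2 ∉ p.1.1 ∧ p.2.2 ∉ p.2.1.1}
  let C := {p : I × I × I × V // p.1.Adj p.2.1 ∧ p.1.Adj p.2.2.1 ∧ p.2.2.2 ∈ p.1.1}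
  refine exists_mulEquiv_of_injective (ι := E ⊕ C) (MonoidHom.pi fun p => Sum.rec
    (fun e => RAAG.edgeHom e.2.1 e.2.2.1 e.2.2.2)
    (fun c => RAAG.cornerHom c.2.1 c.2.2.1 c.2.2.2) p) ?_
  rw [injective_iff_map_eq_one]
  intro k hk
  exact RAAG.eq_one_of_edgeHom_of_cornerHom hG
    (fun {c d} h {x} hc hd => congrFun hk (Sum.inl ⟨(c, d, x), h, hc, hd⟩))
    (fun {c d d'} h h' {x} hc => congrFun hk (Sum.inr ⟨(c, d, d', x), h, h', hc⟩))
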